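/- Let $n$ be a natural number. For a complex $n\times n$ matrix $A$ let $W(A)=\{\langle Ax,x\rangle : x\in\mathbb{C}^n,\ \|x\|=1\}$ be its numerical range, $w(A)=\max\{|z| : z\in W(A)\}$ its numerical radius ($w(A)=0$ if $n=0$), and $\Re A=\frac{A+A^*}{2}$. The matrix $A$ is called accretive if $\Re A$ is positive definite. For $0\le\alpha<\frac{\pi}{2}$ write $A\in\mathcal{S}_\alpha$ if $W(A)\subset\{z\in\mathbb{C} : |\Im z|\le \tan\alpha\,\Re z\}$. For accretive $A,B$ and $t\in(0,1)$ the weighted geometric mean is $$A\sharp_t B=\int_0^1\bigl((1-s)A^{-1}+sB^{-1}\bigr)^{-1}\,d\nu_t(s),\qquad d\nu_t(s)=\frac{\sin(\pi t)}{\pi}\,s^{t-1}(1-s)^{-t}\,ds ,$$ where $\nu_t$ is the probability measure on $[0,1]$ for which $x^t=\int_0^1\bigl((1-s)+sx^{-1}\bigr)^{-1}d\nu_t(s)$ for all $x>0$. Put $A\sharp B=A\sharp_{1/2}B$, and let $$\mathcal{H}_t(A,B)=\frac{A\sharp_t B+A\sharp_{1-t}B}{2}$$ be the Heinz mean. **Theorem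 (Heinz-type inequality).** Let $0\le\alpha<\frac{\pi}{2}$ and let $A,B\in\mathcal{S}_\alpha$ be accretive complex $n\times n$ matrices. Then for every $t\in(0,1)$, $$\cos^4\alpha\; w(A\sharp B)\ \le\ w(\mathcal{H}_t(A,B))\ \le\ \frac{\sec^4\alpha}{2}\; w(A+B).$$ -/

import Mathlib

open scoped Matrix ComplexOrder

namespace Sectorial

open MeasureTheory Set

noncomputable section

/-- The numerical range `W(A) = {⟨A x, x⟩ : x ∈ ℂⁿ, ‖x‖ = 1}`, with the Euclidean norm. Mathlib's
inner product is conjugate-linear in its first argument, so `⟨A x, x⟩` is `inner ℂ x (A x)`. -/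
def numericalRange {n : ℕ} (A : Matrix (Fin n) (Fin n) ℂ) : Set ℂ :=
  {z | ∃ x : EuclideanSpace ℂ (Fin n), ‖x‖ = 1 ∧ inner ℂ x (Matrix.toEuclideanLin A x) = z}

/-- The numerical radius `w(A) = max {|⟨A x, x⟩| : ‖x‖ = 1}`. -/
def numericalRadius {n : ℕ} (A : Matrix (Fin n) (Fin n) ℂ) : ℝ :=
  sSup ((fun z : ℂ => ‖z‖) '' numericalRange A)

/-- The sector `{z : |Im z| ≤ tan α · Re z}`. -/
def sector (α : ℝ) : Set ℂ := {z | |z.im| ≤ Real.tan α * z.re}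

/-- The real part `(A + A*) / 2` of a matrix. -/
def rePart {n : ℕ} (A : Matrix (Fin n) (Fin n) ℂ) : Matrix (Fin n) (Fin n) ℂ :=
  (1 / 2 : ℂ) • (A + Aᴴ)

/-- `A` is accretive if its real part is positive definite. -/
def Accretive {n : ℕ} (A : Matrix (Fin n) (Fin n) ℂ) : Prop := (rePart A).PosDef

/-- The weighted harmonic mean `((1 - s) A⁻¹ + s B⁻¹)⁻¹`. -/
def harmonicMean {n : ℕ} (s : ℝ) (A B : Matrix (Fin n) (Fin n) ℂ) :
    Matrix (Fin n) (Fin n) ℂ :=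
  ((1 - s) • A⁻¹ + s • B⁻¹)⁻¹

/-- The operator mean `∫₀¹ ((1 - s) A⁻¹ + s B⁻¹)⁻¹ dν(s)` with representing measure `ν`; the
matrix-valued integral is taken entrywise. -/
def operatorMean {n : ℕ} (ν : Measure ℝ) (A B : Matrix (Fin n) (Fin n) ℂ) :
    Matrix (Fin n) (Fin n) ℂ :=
  Matrix.of fun i j => ∫ s in Icc (0 : ℝ) 1, harmonicMean s A B i j ∂ν

/-- `ν` is the representing measure of the function `f` on `(0, ∞)`: a probability measure on
`[0, 1]` with `f x = ∫₀¹ ((1 - s) + s x⁻¹)⁻¹ dν(s)` for all `x > 0`. -/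
def IsRepresentingMeasure (ν : Measure ℝ) (f : ℝ → ℝ) : Prop :=
  IsProbabilityMeasure ν ∧ ν (Icc (0 : ℝ) 1)ᶜ = 0 ∧
    ∀ x : ℝ, 0 < x → f x = ∫ s in Icc (0 : ℝ) 1, ((1 - s) + s * x⁻¹)⁻¹ ∂ν

/-- The representing measure of `x ↦ x ^ t`, for `0 < t < 1`: the Beta distribution
`(sin (π t) / π) s ^ (t - 1) (1 - s) ^ (-t) ds` on `(0, 1)`. -/
def powMeasure (t : ℝ) : Measure ℝ := ProbabilityTheory.betaMeasure t (1 - t)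

theorem beta_self_one_sub (t : ℝ) :
    1 / ProbabilityTheory.beta t (1 - t) = Real.sin (Real.pi * t) / Real.pi := by
  rw [ProbabilityTheory.beta, Real.Gamma_mul_Gamma_one_sub, add_sub_cancel, Real.Gamma_one,
    div_one, one_div_div]

theorem integrand_subst {t x y : ℝ} (hx : 0 < x) (hy : y ∈ Ioo (0 : ℝ) 1) :
    |x / (1 - y + x * y) ^ 2| *
      ((x * y / (1 - y + x * y)) ^ (t - 1) * (1 - x * y / (1 - y + x * y)) ^ (1 - t - 1) *
        ((1 - x * y / (1 - y + x * y)) + x * y / (1 - y + x * y) * x⁻¹)⁻¹) =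
      x ^ t * (y ^ (t - 1) * (1 - y) ^ (1 - t - 1)) := by
  obtain ⟨h0, h1⟩ := hy
  have h1' : 0 < 1 - y := by linarith
  have hxy : 0 < x * y := mul_pos hx h0
  have hD : 0 < 1 - y + x * y := by linarith
  have e1 : 1 - x * y / (1 - y + x * y) = (1 - y) / (1 - y + x * y) := by
    field_simp; ring
  rw [e1]
  set D := 1 - y + x * y with hDdef
  have e2 : (1 - y) / D + x * y / D * x⁻¹ = D⁻¹ := by
    field_simp; ring
  rw [e2, inv_inv, abs_of_pos (by positivity), Real.div_rpow hxy.le hD.le,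
    Real.div_rpow h1'.le hD.le, Real.mul_rpow hx.le h0.le]
  have e3 : D ^ (t - 1) * D ^ (1 - t - 1) = D⁻¹ := by
    rw [← Real.rpow_add hD, ← Real.rpow_neg_one]; congr 1; ring
  have e4 : x ^ t = x ^ (t - 1) * x := by
    rw [Real.rpow_sub_one hx.ne']; field_simp
  have p1 := Real.rpow_pos_of_pos hD (t - 1)
  have p2 := Real.rpow_pos_of_pos hD (1 - t - 1)
  have e5 : D ^ (1 - t - 1) = D⁻¹ / D ^ (t - 1) := by
    rw [← e3]; field_simp
  rw [e4, e5]
  field_simp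

theorem image_subst {x : ℝ} (hx : 0 < x) :
    (fun y : ℝ => x * y / (1 - y + x * y)) '' Ioo (0 : ℝ) 1 = Ioo 0 1 := by
  ext s
  constructor
  · rintro ⟨y, ⟨h0, h1⟩, rfl⟩
    have hxy : 0 < x * y := mul_pos hx h0
    have hD : 0 < 1 - y + x * y := by linarith
    exact ⟨div_pos hxy hD, (div_lt_one hD).2 (by linarith)⟩
  · rintro ⟨h0, h1⟩
    have hE : 0 < x * (1 - s) + s := by
      have : 0 < x * (1 - s) := mul_pos hx (by linarith)
      linarith
    have hm : 0 < x * (1 - s) := mul_pos hx (by linarith)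
    refine ⟨s / (x * (1 - s) + s), ⟨div_pos h0 hE, (div_lt_one hE).2 (by linarith)⟩, ?_⟩
    have : 1 - s / (x * (1 - s) + s) + x * (s / (x * (1 - s) + s)) =
        x / (x * (1 - s) + s) := by
      field_simp; ring
    simp only [this]
    field_simp

theorem integral_powMeasure {t : ℝ} (ht : t ∈ Ioo (0 : ℝ) 1) (g : ℝ → ℝ) :
    ∫ s in Icc (0 : ℝ) 1, g s ∂(powMeasure t) =
      1 / ProbabilityTheory.beta t (1 - t) *
        ∫ s in Ioo (0 : ℝ) 1, s ^ (t - 1) * (1 - s) ^ (1 - t - 1) * g s := by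
  have hm : Measurable fun x => (ProbabilityTheory.betaPDFReal t (1 - t) x).toNNReal := by
    fun_prop
  have e : powMeasure t = volume.withDensity
      fun x => ((ProbabilityTheory.betaPDFReal t (1 - t) x).toNNReal : ENNReal) := rfl
  rw [e, setIntegral_withDensity_eq_setIntegral_smul hm _ measurableSet_Icc,
    integral_Icc_eq_integral_Ioo, ← integral_const_mul]
  refine setIntegral_congr_fun measurableSet_Ioo fun s hs => ?_
  have hp := ProbabilityTheory.betaPDFReal_pos hs.1 hs.2 ht.1 (sub_pos.2 ht.2)
  simp only [NNReal.smul_def, Real.coe_toNNReal _ hp.le, smul_eq_mul]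
  rw [ProbabilityTheory.betaPDFReal, if_pos ⟨hs.1, hs.2⟩]
  ring

/-- `powMeasure t` does represent `x ↦ x ^ t`. -/
theorem powMeasure_isRepresentingMeasure {t : ℝ} (ht : t ∈ Ioo (0 : ℝ) 1) :
    IsRepresentingMeasure (powMeasure t) (fun x => x ^ t) := by
  have hP : IsProbabilityMeasure (powMeasure t) :=
    ProbabilityTheory.isProbabilityMeasureBeta ht.1 (sub_pos.2 ht.2)
  have hc : powMeasure t (Icc (0 : ℝ) 1)ᶜ = 0 := by
    rw [powMeasure, ProbabilityTheory.betaMeasure,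
      withDensity_apply _ measurableSet_Icc.compl]
    refine setLIntegral_eq_zero measurableSet_Icc.compl fun x hx => ?_
    rw [mem_compl_iff, mem_Icc, not_and_or, not_le, not_le] at hx
    rcases hx with h | h
    · exact ProbabilityTheory.betaPDF_eq_zero_of_nonpos h.le
    · exact ProbabilityTheory.betaPDF_eq_zero_of_one_le h.le
  refine ⟨hP, hc, fun x hx => ?_⟩
  have hone : ∫ s in Icc (0 : ℝ) 1, (1 : ℝ) ∂(powMeasure t) = 1 := by
    have : powMeasure t (Icc (0 : ℝ) 1) = 1 := (prob_compl_eq_zero_iff measurableSet_Icc).1 hc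
    simp [Measure.real, this]
  rw [integral_powMeasure ht] at hone ⊢
  simp only [mul_one] at hone
  have hder : ∀ y ∈ Ioo (0 : ℝ) 1, HasDerivWithinAt
      (fun y : ℝ => x * y / (1 - y + x * y)) (x / (1 - y + x * y) ^ 2) (Ioo 0 1) y := by
    rintro y ⟨h0, h1⟩
    have hD : 1 - y + x * y ≠ 0 := by nlinarith [mul_pos hx h0]
    have a1 : HasDerivAt (fun y : ℝ => x * y) x y := by
      simpa using (hasDerivAt_id y).const_mul x
    have a2 : HasDerivAt (fun y : ℝ => 1 - y + x * y) (-1 + x) y := by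
      simpa using ((hasDerivAt_id y).const_sub 1).fun_add a1
    have a3 := (a1.fun_div a2 hD).hasDerivWithinAt (s := Ioo (0 : ℝ) 1)
    have e : x * (1 - y + x * y) - x * y * (-1 + x) = x := by ring
    rwa [e] at a3
  have hinj : InjOn (fun y : ℝ => x * y / (1 - y + x * y)) (Ioo 0 1) := by
    rintro y ⟨h0, h1⟩ z ⟨h2, h3⟩ h
    have hD : 1 - y + x * y ≠ 0 := by nlinarith [mul_pos hx h0]
    have hD' : 1 - z + x * z ≠ 0 := by nlinarith [mul_pos hx h2]
    simp only at h
    rw [div_eq_div_iff hD hD'] at h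
    have : x * (y - z) = 0 := by linarith
    rcases mul_eq_zero.1 this with h | h
    · exact absurd h hx.ne'
    · linarith
  have key := integral_image_eq_integral_abs_deriv_smul measurableSet_Ioo hder hinj
    (fun s => s ^ (t - 1) * (1 - s) ^ (1 - t - 1) * ((1 - s) + s * x⁻¹)⁻¹)
  rw [image_subst hx] at key
  rw [key]
  have : ∫ y in Ioo (0 : ℝ) 1, |x / (1 - y + x * y) ^ 2| •
      ((x * y / (1 - y + x * y)) ^ (t - 1) * (1 - x * y / (1 - y + x * y)) ^ (1 - t - 1) *
        ((1 - x * y / (1 - y + x * y)) + x * y / (1 - y + x * y) * x⁻¹)⁻¹) =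
      x ^ t * ∫ y in Ioo (0 : ℝ) 1, y ^ (t - 1) * (1 - y) ^ (1 - t - 1) := by
    rw [← integral_const_mul]
    exact setIntegral_congr_fun measurableSet_Ioo fun y hy => integrand_subst hx hy
  rw [this, mul_left_comm, hone, mul_one]

/-- The weighted geometric mean `A ♯_t B`, `0 < t < 1`: the operator mean of `x ↦ x ^ t`. -/
def geometricMean {n : ℕ} (t : ℝ) (A B : Matrix (Fin n) (Fin n) ℂ) :
    Matrix (Fin n) (Fin n) ℂ :=
  operatorMean (powMeasure t) A B

/-- The Heinz mean `(A ♯_t B + A ♯_{1-t} B) / 2`. -/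
def heinzMean {n : ℕ} (t : ℝ) (A B : Matrix (Fin n) (Fin n) ℂ) :
    Matrix (Fin n) (Fin n) ℂ :=
  (1 / 2 : ℂ) • (geometricMean t A B + geometricMean (1 - t) A B)

end

end Sectorial

namespace Sectorial

open MeasureTheory Set

/-! ### Quadratic forms and inverses of accretive matrices -/

variable {n : ℕ}

/-! Everything is compared, at one vector `x` at a time, with the means of the positive definite
matrices `rePart A` and `rePart B`. Write h for the real part of the form of the harmonic mean of
`A`, `B` at `x`, and h' for that of the real parts. Then h' ≤ h and cos² α · h ≤ h'. Both come from
splitting `x` as (1 - s)u + sv, where `A` at u and `B` at v take the value of the mean at `x`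
(`exists_harmonicMean_splitting`), and from Cauchy–Schwarz, Hermitian for the first and sectorial
for the second.

The harmonic mean is again sectorial, so its form has modulus at most h / cos α. Integrating over
the representing measure gives cos³ α |⟨(A ♯_t B)x, x⟩| ≤ ⟨(Re A ♯_t Re B)x, x⟩ ≤ Re ⟨(A ♯_t B)x,
x⟩.

For positive definite matrices, simultaneous congruence to diagonal form reduces the Heinz
inequality to 2√d ≤ d^t + d^(1-t) ≤ 1 + d for d > 0. Chaining these and taking suprema over unit
vectors yields both bounds. -/

/-- The sesquilinear form `⟨M y, x⟩` of a matrix, conjugate-linear in `x`. -/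
noncomputable def sesqForm (M : Matrix (Fin n) (Fin n) ℂ) (x y : Fin n → ℂ) : ℂ :=
  star x ⬝ᵥ (M *ᵥ y)

theorem sesqForm_add_smul (M : Matrix (Fin n) (Fin n) ℂ) (u v : Fin n → ℂ) (c : ℂ) :
    sesqForm M (u + c • v) (u + c • v) = sesqForm M u u + c * sesqForm M u v +
      star c * sesqForm M v u + star c * c * sesqForm M v v := by
  simp only [sesqForm, star_add, star_smul, Matrix.mulVec_add, Matrix.mulVec_smul,
    add_dotProduct, dotProduct_add, smul_dotProduct, dotProduct_smul, smul_eq_mul]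
  ring

theorem sesqForm_conjTranspose (M : Matrix (Fin n) (Fin n) ℂ) (x y : Fin n → ℂ) :
    sesqForm Mᴴ x y = star (sesqForm M y x) := by
  rw [sesqForm, sesqForm, Matrix.dotProduct_mulVec, ← Matrix.star_mulVec, Matrix.star_dotProduct]

theorem re_sesqForm_rePart (M : Matrix (Fin n) (Fin n) ℂ) (x : Fin n → ℂ) :
    (sesqForm (rePart M) x x).re = (sesqForm M x x).re := by
  have h : sesqForm (rePart M) x x =
      (1 / 2 : ℂ) * (sesqForm M x x + star (sesqForm M x x)) := by
    rw [← sesqForm_conjTranspose]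
    simp only [sesqForm, rePart, Matrix.smul_mulVec, Matrix.add_mulVec, dotProduct_smul,
      dotProduct_add, smul_eq_mul]
  rw [h, Complex.star_def, Complex.add_conj]
  simp

theorem Accretive.re_sesqForm_pos {A : Matrix (Fin n) (Fin n) ℂ} (hA : Accretive A)
    {x : Fin n → ℂ} (hx : x ≠ 0) : 0 < (sesqForm A x x).re := by
  rw [← re_sesqForm_rePart]
  exact (Complex.pos_iff.1 (Matrix.PosDef.dotProduct_mulVec_pos hA hx)).1

/-- A nonzero kernel vector would make the form vanish. -/
theorem isUnit_of_re_sesqForm_pos {M : Matrix (Fin n) (Fin n) ℂ}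
    (h : ∀ x, x ≠ 0 → 0 < (sesqForm M x x).re) : IsUnit M := by
  rw [← Matrix.mulVec_injective_iff_isUnit]
  intro x y hxy
  by_contra hne
  have := h (x - y) (sub_ne_zero.2 hne)
  rw [sesqForm, Matrix.mulVec_sub, hxy, sub_self, dotProduct_zero] at this
  simp at this

theorem Accretive.isUnit {A : Matrix (Fin n) (Fin n) ℂ} (hA : Accretive A) : IsUnit A :=
  isUnit_of_re_sesqForm_pos fun _ => hA.re_sesqForm_pos

theorem Accretive.mulVec_inv_mulVec {A : Matrix (Fin n) (Fin n) ℂ} (hA : Accretive A)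
    (y : Fin n → ℂ) : A *ᵥ (A⁻¹ *ᵥ y) = y := by
  rw [Matrix.mulVec_mulVec, Matrix.mul_nonsing_inv _ ((Matrix.isUnit_iff_isUnit_det A).1 hA.isUnit),
    Matrix.one_mulVec]

/-- With y = Au, the form of `A⁻¹` at y is the conjugate of the form of `A` at u. -/
theorem Accretive.re_sesqForm_inv_pos {A : Matrix (Fin n) (Fin n) ℂ} (hA : Accretive A)
    {y : Fin n → ℂ} (hy : y ≠ 0) : 0 < (sesqForm A⁻¹ y y).re := by
  have hu : A⁻¹ *ᵥ y ≠ 0 := fun h => hy (by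
    have := hA.mulVec_inv_mulVec y
    rw [h, Matrix.mulVec_zero] at this
    exact this.symm)
  have h := hA.re_sesqForm_pos hu
  rw [sesqForm, hA.mulVec_inv_mulVec, Matrix.star_dotProduct, ← sesqForm] at h
  simpa using h

/-! ### Splitting a vector along a harmonic mean -/

theorem sesqForm_convexComb (A B : Matrix (Fin n) (Fin n) ℂ) (s : ℝ) (x : Fin n → ℂ) :
    sesqForm ((1 - s) • A + s • B) x x = (1 - s : ℝ) * sesqForm A x x + s * sesqForm B x x := by
  simp only [sesqForm, Matrix.add_mulVec, Matrix.smul_mulVec, dotProduct_add, dotProduct_smul,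
    Complex.real_smul]

theorem isUnit_convexComb_inv {A B : Matrix (Fin n) (Fin n) ℂ} (hA : Accretive A)
    (hB : Accretive B) {s : ℝ} (hs : s ∈ Icc (0 : ℝ) 1) : IsUnit ((1 - s) • A⁻¹ + s • B⁻¹) := by
  refine isUnit_of_re_sesqForm_pos fun x hx => ?_
  rw [sesqForm_convexComb, Complex.add_re, Complex.re_ofReal_mul, Complex.re_ofReal_mul]
  have h1 := hA.re_sesqForm_inv_pos hx
  have h2 := hB.re_sesqForm_inv_pos hx
  rcases hs.1.eq_or_lt with h | h
  · subst h; simpa using h1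
  · have := mul_nonneg (sub_nonneg.2 hs.2) h1.le
    have := mul_pos h h2
    linarith

/-- Every vector splits as a convex combination on which `A` and `B` act as their weighted
harmonic mean does. -/
theorem exists_harmonicMean_splitting {A B : Matrix (Fin n) (Fin n) ℂ} (hA : Accretive A)
    (hB : Accretive B) {s : ℝ} (hs : s ∈ Icc (0 : ℝ) 1) (x : Fin n → ℂ) :
    ∃ u v : Fin n → ℂ, (1 - s) • u + s • v = x ∧ A *ᵥ u = harmonicMean s A B *ᵥ x ∧
      B *ᵥ v = harmonicMean s A B *ᵥ x := by
  refine ⟨A⁻¹ *ᵥ (harmonicMean s A B *ᵥ x), B⁻¹ *ᵥ (harmonicMean s A B *ᵥ x), ?_,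
    hA.mulVec_inv_mulVec _, hB.mulVec_inv_mulVec _⟩
  rw [← Matrix.smul_mulVec, ← Matrix.smul_mulVec, ← Matrix.add_mulVec, harmonicMean,
    Matrix.mulVec_mulVec, Matrix.mul_nonsing_inv _ ((Matrix.isUnit_iff_isUnit_det _).1
      (isUnit_convexComb_inv hA hB hs)), Matrix.one_mulVec]

theorem star_convexComb_dotProduct (s : ℝ) (u v y : Fin n → ℂ) :
    star ((1 - s) • u + s • v) ⬝ᵥ y = (1 - s : ℝ) * (star u ⬝ᵥ y) + s * (star v ⬝ᵥ y) := by
  simp only [star_add, star_smul, star_trivial, add_dotProduct, smul_dotProduct,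
    Complex.real_smul]

/-- The test pair u', v' is arbitrary: inserting the splitting of a different mean produces the
cross terms to which Cauchy–Schwarz is applied. -/
theorem star_dotProduct_harmonicMean {A B : Matrix (Fin n) (Fin n) ℂ} {s : ℝ}
    {x u v : Fin n → ℂ} (hu : A *ᵥ u = harmonicMean s A B *ᵥ x)
    (hv : B *ᵥ v = harmonicMean s A B *ᵥ x) (u' v' : Fin n → ℂ) :
    star ((1 - s) • u' + s • v') ⬝ᵥ (harmonicMean s A B *ᵥ x) =
      (1 - s : ℝ) * sesqForm A u' u + s * sesqForm B v' v := by
  rw [star_convexComb_dotProduct, sesqForm, sesqForm, hu, hv]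

/-! ### Sectorial forms and their Cauchy–Schwarz inequality -/

/-- The quadratic form of `M` takes its values in the sector of half-angle `α`. -/
def FormSectorial (α : ℝ) (M : Matrix (Fin n) (Fin n) ℂ) : Prop :=
  ∀ x, sesqForm M x x ∈ sector α

theorem inner_toEuclideanLin (M : Matrix (Fin n) (Fin n) ℂ) (x : EuclideanSpace ℂ (Fin n)) :
    inner ℂ x (Matrix.toEuclideanLin M x) = sesqForm M x.ofLp x.ofLp := by
  rw [EuclideanSpace.inner_eq_star_dotProduct, sesqForm, dotProduct_comm]
  rfl

theorem sesqForm_mem_numericalRange {M : Matrix (Fin n) (Fin n) ℂ}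
    {x : EuclideanSpace ℂ (Fin n)} (hx : ‖x‖ = 1) :
    sesqForm M x.ofLp x.ofLp ∈ numericalRange M :=
  ⟨x, hx, inner_toEuclideanLin M x⟩

theorem formSectorial_of_numericalRange_subset {α : ℝ} {M : Matrix (Fin n) (Fin n) ℂ}
    (h : numericalRange M ⊆ sector α) : FormSectorial α M := by
  intro x
  by_cases hx : x = 0
  · simp [hx, sesqForm, sector]
  have hne : WithLp.toLp 2 x ≠ 0 := by simpa using hx
  have hpos : 0 < ‖WithLp.toLp 2 x‖ := norm_pos_iff.2 hne
  have hunit : ‖((‖WithLp.toLp 2 x‖⁻¹ : ℝ) : ℂ) • WithLp.toLp 2 x‖ = 1 := by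
    rw [norm_smul, Complex.norm_real, norm_inv, norm_norm, inv_mul_cancel₀ hpos.ne']
  have hm := h (sesqForm_mem_numericalRange (M := M) hunit)
  have e : sesqForm M (((‖WithLp.toLp 2 x‖⁻¹ : ℝ) : ℂ) • WithLp.toLp 2 x).ofLp
      (((‖WithLp.toLp 2 x‖⁻¹ : ℝ) : ℂ) • WithLp.toLp 2 x).ofLp =
      ((‖WithLp.toLp 2 x‖⁻¹ ^ 2 : ℝ) : ℂ) * sesqForm M x x := by
    simp only [sesqForm, WithLp.ofLp_smul, Matrix.mulVec_smul, star_smul, smul_dotProduct,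
      dotProduct_smul, smul_eq_mul, Complex.star_def, Complex.conj_ofReal]
    push_cast; ring
  rw [e] at hm
  simp only [sector, mem_ofPred_eq, Complex.im_ofReal_mul, Complex.re_ofReal_mul, abs_mul] at hm ⊢
  have hp : 0 < ‖WithLp.toLp 2 x‖⁻¹ ^ 2 := by positivity
  rw [abs_of_pos hp] at hm
  refine le_of_mul_le_mul_left ?_ hp
  linarith

theorem norm_mul_cos_le_re {α : ℝ} (hα₀ : 0 ≤ α) (hα₁ : α < Real.pi / 2) {z : ℂ}
    (hz : z ∈ sector α) (hre : 0 ≤ z.re) : Real.cos α * ‖z‖ ≤ z.re := by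
  have hc : 0 < Real.cos α := Real.cos_pos_of_mem_Ioo ⟨by linarith [Real.pi_pos], hα₁⟩
  have hs : 0 ≤ Real.sin α := Real.sin_nonneg_of_nonneg_of_le_pi hα₀ (by linarith [Real.pi_pos])
  have hz' : |z.im| ≤ Real.tan α * z.re := hz
  rw [Real.tan_eq_sin_div_cos, div_mul_eq_mul_div, le_div_iff₀ hc] at hz'
  have h2 : (|z.im| * Real.cos α) ^ 2 ≤ (Real.sin α * z.re) ^ 2 :=
    pow_le_pow_left₀ (by positivity) hz' 2
  rw [mul_pow, sq_abs] at h2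
  refine abs_le_of_sq_le_sq' ?_ hre |>.2
  rw [mul_pow, Complex.sq_norm, Complex.normSq_apply]
  nlinarith [Real.sin_sq_add_cos_sq α]

/-- The Cauchy–Schwarz inequality for sectorial forms, in additive form. -/
theorem two_mul_cos_mul_re_sesqForm_le {α : ℝ} (hα₀ : 0 ≤ α) (hα₁ : α < Real.pi / 2)
    {M : Matrix (Fin n) (Fin n) ℂ} (hM : FormSectorial α M)
    (hre : ∀ x, 0 ≤ (sesqForm M x x).re) (u v : Fin n → ℂ) :
    2 * Real.cos α * (sesqForm M v u).re ≤ (sesqForm M u u).re + (sesqForm M v v).re := by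
  have hc : 0 < Real.cos α := Real.cos_pos_of_mem_Ioo ⟨by linarith [Real.pi_pos], hα₁⟩
  have hf : ∀ w, |(sesqForm M w w).im| * Real.cos α ≤ Real.sin α * (sesqForm M w w).re := by
    intro w
    have := hM w
    simp only [sector, mem_ofPred_eq] at this
    rwa [Real.tan_eq_sin_div_cos, div_mul_eq_mul_div, le_div_iff₀ hc] at this
  -- The general argument ends by cancelling sin α. At α = 0 the form is real, and evaluating at u +
  -- iv shows that its two cross terms have equal real part.
  rcases hα₀.eq_or_lt with h0 | h0
  · subst h0
    simp only [Real.cos_zero, Real.sin_zero, mul_one, zero_mul, abs_nonpos_iff] at hf ⊢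
    have h1 := hf (u + Complex.I • v)
    have h2 := hre (u + (-1 : ℂ) • v)
    rw [sesqForm_add_smul] at h1 h2
    have hu := hf u
    have hv := hf v
    simp at h1 h2
    linarith
  · have hs : 0 < Real.sin α := Real.sin_pos_of_pos_of_lt_pi h0 (by linarith [Real.pi_pos])
    have hsc := Real.sin_sq_add_cos_sq α
    set S := Real.sin α
    set C := Real.cos α
    -- The scalars are -e^(-iα) and -e^(iα). Pairing each with the opposite edge of the sector makes
    -- the `sesqForm M u v` terms cancel in the sum, leaving 2 sin 2α times the real part of
    -- `sesqForm M v u`.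
    have h1 := hf (u + (⟨-C, S⟩ : ℂ) • v)
    have h2 := hf (u + (⟨-C, -S⟩ : ℂ) • v)
    have h1' := (mul_le_mul_of_nonneg_right (neg_le_abs _) hc.le).trans h1
    have h2' := (mul_le_mul_of_nonneg_right (le_abs_self _) hc.le).trans h2
    rw [sesqForm_add_smul] at h1' h2'
    simp only [Complex.add_re, Complex.add_im, Complex.mul_re, Complex.mul_im, Complex.star_def,
      Complex.conj_re, Complex.conj_im] at h1' h2'
    refine le_of_mul_le_mul_left ?_ hs
    refine le_of_mul_le_mul_left ?_ (two_pos (α := ℝ))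
    set a := sesqForm M u u
    set b := sesqForm M u v
    set c := sesqForm M v u
    set d := sesqForm M v v
    linear_combination h1' + h2' + 2 * S * d.re * hsc

theorem Accretive.re_sesqForm_nonneg {A : Matrix (Fin n) (Fin n) ℂ} (hA : Accretive A)
    (x : Fin n → ℂ) : 0 ≤ (sesqForm A x x).re := by
  by_cases hx : x = 0
  · simp [hx, sesqForm]
  · exact (hA.re_sesqForm_pos hx).le

theorem rePart_eq_self {P : Matrix (Fin n) (Fin n) ℂ} (hP : P.IsHermitian) : rePart P = P := by
  rw [rePart, hP.eq, ← two_smul ℂ P, smul_smul]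
  norm_num

theorem accretive_of_posDef {P : Matrix (Fin n) (Fin n) ℂ} (hP : P.PosDef) : Accretive P := by
  rwa [Accretive, rePart_eq_self hP.isHermitian]

theorem re_sesqForm_symm {P : Matrix (Fin n) (Fin n) ℂ} (hP : P.IsHermitian) (x y : Fin n → ℂ) :
    (sesqForm P x y).re = (sesqForm P y x).re := by
  rw [← hP.eq, sesqForm_conjTranspose, hP.eq, Complex.star_def, Complex.conj_re]

theorem two_mul_re_sesqForm_le {P : Matrix (Fin n) (Fin n) ℂ} (hP : P.PosDef)
    (u v : Fin n → ℂ) :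
    2 * (sesqForm P u v).re ≤ (sesqForm P u u).re + (sesqForm P v v).re := by
  have h := (accretive_of_posDef hP).re_sesqForm_nonneg (u + (-1 : ℂ) • v)
  rw [sesqForm_add_smul] at h
  have hs := re_sesqForm_symm hP.isHermitian u v
  simp at h
  linarith

/-! ### Comparing harmonic means with those of the real parts -/

section Pointwise

variable {A B : Matrix (Fin n) (Fin n) ℂ} {s : ℝ}

/-- The harmonic mean of the real parts is at most the real part of the harmonic mean. -/
theorem re_harmonicMean_rePart_le (hA : Accretive A) (hB : Accretive B)
    (hs : s ∈ Icc (0 : ℝ) 1) (x : Fin n → ℂ) :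
    (sesqForm (harmonicMean s (rePart A) (rePart B)) x x).re ≤
      (sesqForm (harmonicMean s A B) x x).re := by
  obtain ⟨u, v, huv, hu, hv⟩ := exists_harmonicMean_splitting hA hB hs x
  obtain ⟨u', v', huv', hu', hv'⟩ := exists_harmonicMean_splitting
    (accretive_of_posDef hA) (accretive_of_posDef hB) hs x
  have e1 := star_dotProduct_harmonicMean (s := s) hu hv u v
  -- Testing the mean of the real parts against the splitting for `A`, `B` expresses h' by cross
  -- terms, so Cauchy–Schwarz gives 2h' ≤ h + h'.
  have e2 := star_dotProduct_harmonicMean (s := s) hu' hv' u v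
  have e3 := star_dotProduct_harmonicMean (s := s) hu' hv' u' v'
  rw [huv, ← sesqForm] at e1 e2
  rw [huv', ← sesqForm] at e3
  replace e1 := congrArg Complex.re e1
  replace e2 := congrArg Complex.re e2
  replace e3 := congrArg Complex.re e3
  simp only [Complex.add_re, Complex.re_ofReal_mul] at e1 e2 e3
  have i1 := mul_le_mul_of_nonneg_left (two_mul_re_sesqForm_le hA u u') (sub_nonneg.2 hs.2)
  have i2 := mul_le_mul_of_nonneg_left (two_mul_re_sesqForm_le hB v v') hs.1
  rw [re_sesqForm_rePart A u] at i1
  rw [re_sesqForm_rePart B v] at i2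
  linarith

theorem re_sesqForm_harmonicMean_nonneg (hA : Accretive A) (hB : Accretive B)
    (hs : s ∈ Icc (0 : ℝ) 1) (x : Fin n → ℂ) :
    0 ≤ (sesqForm (harmonicMean s A B) x x).re := by
  obtain ⟨u, v, huv, hu, hv⟩ := exists_harmonicMean_splitting hA hB hs x
  have e1 := star_dotProduct_harmonicMean (s := s) hu hv u v
  rw [huv, ← sesqForm] at e1
  rw [e1, Complex.add_re, Complex.re_ofReal_mul, Complex.re_ofReal_mul]
  exact add_nonneg (mul_nonneg (sub_nonneg.2 hs.2) (hA.re_sesqForm_nonneg _))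
    (mul_nonneg hs.1 (hB.re_sesqForm_nonneg _))

/-- At `x` the form is a convex combination of a value of the form of `A` and one of `B`, and the
sector is convex. -/
theorem formSectorial_harmonicMean {α : ℝ} (hA : Accretive A) (hB : Accretive B)
    (hAα : FormSectorial α A) (hBα : FormSectorial α B) (hs : s ∈ Icc (0 : ℝ) 1) :
    FormSectorial α (harmonicMean s A B) := by
  intro x
  obtain ⟨u, v, huv, hu, hv⟩ := exists_harmonicMean_splitting hA hB hs x
  have e1 := star_dotProduct_harmonicMean (s := s) hu hv u v
  rw [huv, ← sesqForm] at e1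
  have h1 := hAα u
  have h2 := hBα v
  simp only [sector, mem_ofPred_eq] at h1 h2 ⊢
  rw [e1, Complex.add_re, Complex.re_ofReal_mul, Complex.re_ofReal_mul, Complex.add_im,
    Complex.im_ofReal_mul, Complex.im_ofReal_mul]
  have h3 := abs_add_le ((1 - s) * (sesqForm A u u).im) (s * (sesqForm B v v).im)
  rw [abs_mul, abs_mul, abs_of_nonneg hs.1, abs_of_nonneg (sub_nonneg.2 hs.2)] at h3
  have i1 := mul_le_mul_of_nonneg_left h1 (sub_nonneg.2 hs.2)
  have i2 := mul_le_mul_of_nonneg_left h2 hs.1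
  linarith

/-- The real part of the harmonic mean of sectorial matrices is at most `sec² α` times the
harmonic mean of the real parts. -/
theorem cos_sq_mul_re_harmonicMean_le {α : ℝ} (hα₀ : 0 ≤ α) (hα₁ : α < Real.pi / 2)
    (hA : Accretive A) (hB : Accretive B) (hAα : FormSectorial α A) (hBα : FormSectorial α B)
    (hs : s ∈ Icc (0 : ℝ) 1) (x : Fin n → ℂ) :
    Real.cos α ^ 2 * (sesqForm (harmonicMean s A B) x x).re ≤
      (sesqForm (harmonicMean s (rePart A) (rePart B)) x x).re := by
  obtain ⟨u, v, huv, hu, hv⟩ := exists_harmonicMean_splitting hA hB hs x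
  obtain ⟨u', v', huv', hu', hv'⟩ := exists_harmonicMean_splitting
    (accretive_of_posDef hA) (accretive_of_posDef hB) hs x
  have e1 := star_dotProduct_harmonicMean (s := s) hu hv u v
  -- Here the roles are reversed: h itself is written by cross terms of `A` and `B`, giving 2 cos² α
  -- · h ≤ cos² α · h + h'.
  have e2 := star_dotProduct_harmonicMean (s := s) hu hv u' v'
  have e3 := star_dotProduct_harmonicMean (s := s) hu' hv' u' v'
  rw [huv, ← sesqForm] at e1
  rw [huv', ← sesqForm] at e2 e3
  replace e1 := congrArg Complex.re e1
  replace e2 := congrArg Complex.re e2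
  replace e3 := congrArg Complex.re e3
  simp only [Complex.add_re, Complex.re_ofReal_mul, re_sesqForm_rePart] at e1 e2 e3
  have key : ∀ {M : Matrix (Fin n) (Fin n) ℂ}, FormSectorial α M → Accretive M →
      ∀ a b : Fin n → ℂ, 2 * Real.cos α ^ 2 * (sesqForm M b a).re ≤
        Real.cos α ^ 2 * (sesqForm M a a).re + (sesqForm M b b).re := by
    intro M hM hM' a b
    -- Scaling a by cos α gives the factor cos² α to the form at a only, so that the h terms can be
    -- absorbed.
    have h := two_mul_cos_mul_re_sesqForm_le hα₀ hα₁ hM hM'.re_sesqForm_nonneg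
      (((Real.cos α : ℝ) : ℂ) • a) b
    simp only [sesqForm, Matrix.mulVec_smul, star_smul, smul_dotProduct, dotProduct_smul,
      smul_eq_mul, Complex.star_def, Complex.conj_ofReal, Complex.re_ofReal_mul] at h ⊢
    linarith
  have i1 := mul_le_mul_of_nonneg_left (key hAα hA u u') (sub_nonneg.2 hs.2)
  have i2 := mul_le_mul_of_nonneg_left (key hBα hB v v') hs.1
  have e1' := congrArg (Real.cos α ^ 2 * ·) e1
  have e2' := congrArg (Real.cos α ^ 2 * ·) e2
  linarith

end Pointwise

/-! ### Simultaneous diagonalization by congruence -/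

section Diagonalization

theorem exists_conjTranspose_mul_self {P : Matrix (Fin n) (Fin n) ℂ} (hP : P.PosDef) :
    ∃ C : Matrix (Fin n) (Fin n) ℂ, IsUnit C ∧ P = Cᴴ * C := by
  open scoped MatrixOrder in
  obtain ⟨C, hC⟩ := CStarAlgebra.nonneg_iff_eq_star_mul_self.mp hP.posSemidef.nonneg
  refine ⟨C, ?_, hC⟩
  have h := hP.isUnit
  rw [hC, Matrix.isUnit_iff_isUnit_det, Matrix.det_mul] at h
  exact (Matrix.isUnit_iff_isUnit_det C).2 (isUnit_of_mul_isUnit_right h)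

/-- Two positive definite matrices are simultaneously congruent to diagonal ones. -/
theorem exists_simultaneous_diagonalization {P Q : Matrix (Fin n) (Fin n) ℂ} (hP : P.PosDef)
    (hQ : Q.PosDef) : ∃ (d : Fin n → ℝ) (S : Matrix (Fin n) (Fin n) ℂ), (∀ i, 0 < d i) ∧
      IsUnit S ∧ P = Sᴴ * S ∧ Q = Sᴴ * Matrix.diagonal (fun i => (d i : ℂ)) * S := by
  obtain ⟨C, hC, hPC⟩ := exists_conjTranspose_mul_self hP
  have hCd := (Matrix.isUnit_iff_isUnit_det C).1 hC
  -- Congruence by C⁻¹ sends P to the identity. A unitary U diagonalizing the transformed Q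
  -- preserves the identity, so S = U*C serves both.
  have hR : (C⁻¹ᴴ * Q * C⁻¹).PosDef := by
    refine hQ.conjTranspose_mul_mul_same ?_
    exact Matrix.mulVec_injective_iff_isUnit.2 (by
      rw [Matrix.isUnit_iff_isUnit_det]
      exact Matrix.isUnit_nonsing_inv_det C hCd)
  have hspec := hR.isHermitian.spectral_theorem
  rw [Unitary.conjStarAlgAut_apply] at hspec
  set U : Matrix (Fin n) (Fin n) ℂ := (hR.isHermitian.eigenvectorUnitary).1
  have hU1 : Uᴴ * U = 1 := Unitary.coe_star_mul_self hR.isHermitian.eigenvectorUnitary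
  have hU2 : U * Uᴴ = 1 := Unitary.coe_mul_star_self hR.isHermitian.eigenvectorUnitary
  refine ⟨hR.isHermitian.eigenvalues, Uᴴ * C, hR.eigenvalues_pos, ?_, ?_, ?_⟩
  · exact (IsUnit.of_mul_eq_one _ hU1).mul hC
  · rw [Matrix.conjTranspose_mul, Matrix.conjTranspose_conjTranspose, Matrix.mul_assoc,
      ← Matrix.mul_assoc U, hU2, Matrix.one_mul, hPC]
  · have hQ' : Q = Cᴴ * (C⁻¹ᴴ * Q * C⁻¹) * C := by
      have h1 : Cᴴ * C⁻¹ᴴ = 1 := by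
        rw [← Matrix.conjTranspose_mul, Matrix.nonsing_inv_mul _ hCd, Matrix.conjTranspose_one]
      rw [Matrix.mul_assoc, Matrix.mul_assoc, Matrix.nonsing_inv_mul _ hCd, Matrix.mul_one,
        ← Matrix.mul_assoc, h1, Matrix.one_mul]
    refine (hQ'.trans (congrArg (fun X => Cᴴ * X * C) hspec)).trans ?_
    generalize hR.isHermitian.eigenvalues = d
    have hd : (RCLike.ofReal ∘ d : Fin n → ℂ) = fun i => (d i : ℂ) := rfl
    simp only [hd, Matrix.star_eq_conjTranspose, Matrix.conjTranspose_mul,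
      Matrix.conjTranspose_conjTranspose, Matrix.mul_assoc]

/-- Inversion turns congruence by S into congruence by S⁻¹*, under which linear combinations are
preserved; the second inversion turns it back. -/
theorem harmonicMean_congruence {d : Fin n → ℝ} (hd : ∀ i, 0 < d i)
    {S : Matrix (Fin n) (Fin n) ℂ} (hS : IsUnit S) {s : ℝ} (hs : s ∈ Icc (0 : ℝ) 1) :
    harmonicMean s (Sᴴ * S) (Sᴴ * Matrix.diagonal (fun i => (d i : ℂ)) * S) =
      Sᴴ * Matrix.diagonal (fun i => ((((1 - s) + s * (d i)⁻¹)⁻¹ : ℝ) : ℂ)) * S := by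
  have hSd := (Matrix.isUnit_iff_isUnit_det S).1 hS
  have hSd' : IsUnit Sᴴ.det := by rw [Matrix.det_conjTranspose]; exact hSd.star
  have hinv : ∀ e : Fin n → ℝ, (∀ i, e i ≠ 0) →
      (Matrix.diagonal fun i => ((e i : ℝ) : ℂ))⁻¹ =
        Matrix.diagonal fun i => (((e i)⁻¹ : ℝ) : ℂ) := by
    intro e he
    refine Matrix.inv_eq_right_inv ?_
    rw [Matrix.diagonal_mul_diagonal, ← Matrix.diagonal_one]
    congr 1
    ext i
    rw [← Complex.ofReal_mul, mul_inv_cancel₀ (he i), Complex.ofReal_one]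
  have he : ∀ i, (1 - s) + s * (d i)⁻¹ ≠ 0 := by
    intro i
    have hi := inv_pos.2 (hd i)
    rcases hs.1.eq_or_lt with h | h
    · subst h; simp
    · have := mul_pos h hi
      have := hs.2
      linarith
  have h : (1 - s) • (Sᴴ * S)⁻¹ + s • (Sᴴ * Matrix.diagonal (fun i => (d i : ℂ)) * S)⁻¹ =
      S⁻¹ * Matrix.diagonal (fun i => (((1 - s) + s * (d i)⁻¹ : ℝ) : ℂ)) * Sᴴ⁻¹ := by
    rw [Matrix.mul_inv_rev, Matrix.mul_inv_rev, Matrix.mul_inv_rev, hinv d fun i => (hd i).ne',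
      ← Matrix.mul_assoc]
    have hdiag : Matrix.diagonal (fun i => (((1 - s) + s * (d i)⁻¹ : ℝ) : ℂ)) =
        (1 - s) • (1 : Matrix (Fin n) (Fin n) ℂ) +
          s • Matrix.diagonal (fun i => (((d i)⁻¹ : ℝ) : ℂ)) := by
      rw [← Matrix.diagonal_one, ← Matrix.diagonal_smul, ← Matrix.diagonal_smul,
        Matrix.diagonal_add]
      congr 1
      ext i
      simp
    rw [hdiag, Matrix.mul_add, Matrix.add_mul, Matrix.mul_smul, Matrix.mul_smul, Matrix.smul_mul,
      Matrix.smul_mul, Matrix.mul_one]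
  rw [harmonicMean, h, Matrix.mul_inv_rev, Matrix.mul_inv_rev, Matrix.nonsing_inv_nonsing_inv _ hSd,
    Matrix.nonsing_inv_nonsing_inv _ hSd', hinv _ he, ← Matrix.mul_assoc]

theorem re_sesqForm_congruence_diagonal (S : Matrix (Fin n) (Fin n) ℂ) (e : Fin n → ℝ)
    (x : Fin n → ℂ) :
    (sesqForm (Sᴴ * Matrix.diagonal (fun i => (e i : ℂ)) * S) x x).re =
      ∑ i, e i * ‖(S *ᵥ x) i‖ ^ 2 := by
  rw [sesqForm, ← Matrix.mulVec_mulVec, ← Matrix.mulVec_mulVec, Matrix.dotProduct_mulVec,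
    ← Matrix.star_mulVec, dotProduct, Complex.re_sum]
  refine Finset.sum_congr rfl fun i _ => ?_
  rw [Matrix.mulVec_diagonal, Pi.star_apply, mul_left_comm, Complex.re_ofReal_mul,
    Complex.star_def, Complex.conj_mul', ← Complex.ofReal_pow, Complex.ofReal_re]

end Diagonalization

/-! ### Numerical radius bounds from the form -/

section NumericalRadius

theorem norm_sesqForm_le_numericalRadius (M : Matrix (Fin n) (Fin n) ℂ)
    {x : EuclideanSpace ℂ (Fin n)} (hx : ‖x‖ = 1) :
    ‖sesqForm M x.ofLp x.ofLp‖ ≤ numericalRadius M := by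
  -- The operator norm bounds the set, as the supremum requires.
  refine le_csSup ⟨‖Matrix.toEuclideanLin M |>.toContinuousLinearMap‖, ?_⟩
    ⟨_, sesqForm_mem_numericalRange hx, rfl⟩
  rintro _ ⟨_, ⟨y, hy, rfl⟩, rfl⟩
  have h1 := norm_inner_le_norm (𝕜 := ℂ) y (Matrix.toEuclideanLin M y)
  have h2 := (Matrix.toEuclideanLin M |>.toContinuousLinearMap).le_opNorm y
  simp only [LinearMap.coe_toContinuousLinearMap'] at h2
  rw [hy, one_mul] at h1
  rw [hy, mul_one] at h2
  exact h1.trans h2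

theorem numericalRadius_nonneg (M : Matrix (Fin n) (Fin n) ℂ) : 0 ≤ numericalRadius M :=
  Real.sSup_nonneg (by rintro _ ⟨z, -, rfl⟩; exact norm_nonneg z)

/-- Nonnegativity of `c` covers n = 0, where there are no unit vectors and the supremum is 0. -/
theorem numericalRadius_le {M : Matrix (Fin n) (Fin n) ℂ} {c : ℝ} (hc : 0 ≤ c)
    (h : ∀ x : EuclideanSpace ℂ (Fin n), ‖x‖ = 1 → ‖sesqForm M x.ofLp x.ofLp‖ ≤ c) :
    numericalRadius M ≤ c := by
  refine Real.sSup_le ?_ hc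
  rintro _ ⟨_, ⟨y, hy, rfl⟩, rfl⟩
  simpa only [inner_toEuclideanLin] using h y hy

end NumericalRadius

/-! ### Integrating over the representing measure -/

section Integral

variable {A B : Matrix (Fin n) (Fin n) ℂ} {t : ℝ}

theorem isProbabilityMeasure_powMeasure (ht : t ∈ Ioo (0 : ℝ) 1) :
    IsProbabilityMeasure (powMeasure t) :=
  (powMeasure_isRepresentingMeasure ht).1

theorem continuousOn_harmonicMean (hA : Accretive A) (hB : Accretive B) :
    ContinuousOn (fun s : ℝ => harmonicMean s A B) (Icc 0 1) := by
  intro s hs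
  have h1 : ContinuousAt (fun s : ℝ => (1 - s) • A⁻¹ + s • B⁻¹) s := by fun_prop
  have hdet := (Matrix.isUnit_iff_isUnit_det _).1 (isUnit_convexComb_inv hA hB hs)
  have h2 : ContinuousAt Inv.inv ((1 - s) • A⁻¹ + s • B⁻¹) := by
    refine continuousAt_matrix_inv _ ?_
    rw [Ring.inverse_eq_inv']
    exact continuousAt_inv₀ hdet.ne_zero
  exact (ContinuousAt.comp (f := fun s : ℝ => (1 - s) • A⁻¹ + s • B⁻¹) h2 h1).continuousWithinAt

theorem integrableOn_harmonicMean_apply (hA : Accretive A) (hB : Accretive B)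
    (ht : t ∈ Ioo (0 : ℝ) 1) (i j : Fin n) :
    IntegrableOn (fun s => harmonicMean s A B i j) (Icc 0 1) (powMeasure t) := by
  have := isProbabilityMeasure_powMeasure ht
  refine ContinuousOn.integrableOn_compact isCompact_Icc ?_
  exact (continuous_apply_apply i j).comp_continuousOn (continuousOn_harmonicMean hA hB)

theorem sesqForm_eq_sum (M : Matrix (Fin n) (Fin n) ℂ) (x y : Fin n → ℂ) :
    sesqForm M x y = ∑ i, ∑ j, star (x i) * y j * M i j := by
  simp only [sesqForm, dotProduct, Matrix.mulVec, Finset.mul_sum, Pi.star_apply]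
  exact Finset.sum_congr rfl fun i _ => Finset.sum_congr rfl fun j _ => by ring

theorem integrableOn_sesqForm_harmonicMean (hA : Accretive A) (hB : Accretive B)
    (ht : t ∈ Ioo (0 : ℝ) 1) (x y : Fin n → ℂ) :
    IntegrableOn (fun s => sesqForm (harmonicMean s A B) x y) (Icc 0 1) (powMeasure t) := by
  simp only [sesqForm_eq_sum]
  exact integrable_finsetSum _ fun i _ => integrable_finsetSum _ fun j _ =>
    (integrableOn_harmonicMean_apply hA hB ht i j).const_mul _

theorem sesqForm_geometricMean (hA : Accretive A) (hB : Accretive B)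
    (ht : t ∈ Ioo (0 : ℝ) 1) (x y : Fin n → ℂ) :
    sesqForm (geometricMean t A B) x y =
      ∫ s in Icc (0 : ℝ) 1, sesqForm (harmonicMean s A B) x y ∂(powMeasure t) := by
  have hint := integrableOn_harmonicMean_apply hA hB ht
  simp only [sesqForm_eq_sum]
  rw [integral_finsetSum _ fun i _ => integrable_finsetSum _ fun j _ => (hint i j).const_mul _]
  refine Finset.sum_congr rfl fun i _ => ?_
  rw [integral_finsetSum _ fun j _ => (hint i j).const_mul _]
  refine Finset.sum_congr rfl fun j _ => ?_
  rw [integral_const_mul]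
  rfl

theorem re_sesqForm_geometricMean (hA : Accretive A) (hB : Accretive B)
    (ht : t ∈ Ioo (0 : ℝ) 1) (x : Fin n → ℂ) :
    (sesqForm (geometricMean t A B) x x).re =
      ∫ s in Icc (0 : ℝ) 1, (sesqForm (harmonicMean s A B) x x).re ∂(powMeasure t) := by
  rw [sesqForm_geometricMean hA hB ht]
  exact (integral_re (integrableOn_sesqForm_harmonicMean hA hB ht x x)).symm

theorem re_geometricMean_rePart_le (hA : Accretive A) (hB : Accretive B)
    (ht : t ∈ Ioo (0 : ℝ) 1) (x : Fin n → ℂ) :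
    (sesqForm (geometricMean t (rePart A) (rePart B)) x x).re ≤
      (sesqForm (geometricMean t A B) x x).re := by
  have hP := accretive_of_posDef hA
  have hQ := accretive_of_posDef hB
  rw [re_sesqForm_geometricMean hA hB ht, re_sesqForm_geometricMean hP hQ ht]
  exact setIntegral_mono_on (integrableOn_sesqForm_harmonicMean hP hQ ht x x).re
    (integrableOn_sesqForm_harmonicMean hA hB ht x x).re measurableSet_Icc
    fun s hs => re_harmonicMean_rePart_le hA hB hs x

/-- One factor cos α bounds the modulus by the real part under the integral; the other two come from
comparing harmonic means. -/
theorem cos_pow_three_mul_norm_geometricMean_le {α : ℝ} (hα₀ : 0 ≤ α) (hα₁ : α < Real.pi / 2)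
    (hA : Accretive A) (hB : Accretive B) (hAα : FormSectorial α A) (hBα : FormSectorial α B)
    (ht : t ∈ Ioo (0 : ℝ) 1) (x : Fin n → ℂ) :
    Real.cos α ^ 3 * ‖sesqForm (geometricMean t A B) x x‖ ≤
      (sesqForm (geometricMean t (rePart A) (rePart B)) x x).re := by
  have hc : 0 < Real.cos α := Real.cos_pos_of_mem_Ioo ⟨by linarith [Real.pi_pos], hα₁⟩
  have hP := accretive_of_posDef hA
  have hQ := accretive_of_posDef hB
  have hint := integrableOn_sesqForm_harmonicMean hA hB ht x x
  rw [sesqForm_geometricMean hA hB ht, re_sesqForm_geometricMean hP hQ ht]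
  refine (mul_le_mul_of_nonneg_left (norm_integral_le_integral_norm _) (by positivity)).trans ?_
  rw [← integral_const_mul]
  refine setIntegral_mono_on (hint.norm.const_mul _)
    (integrableOn_sesqForm_harmonicMean hP hQ ht x x).re measurableSet_Icc fun s hs => ?_
  have h1 := norm_mul_cos_le_re hα₀ hα₁ (formSectorial_harmonicMean hA hB hAα hBα hs x)
    (re_sesqForm_harmonicMean_nonneg hA hB hs x)
  have h2 := cos_sq_mul_re_harmonicMean_le hα₀ hα₁ hA hB hAα hBα hs x
  have h3 := mul_le_mul_of_nonneg_left h1 (sq_nonneg (Real.cos α))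
  calc Real.cos α ^ 3 * ‖sesqForm (harmonicMean s A B) x x‖
      = Real.cos α ^ 2 * (Real.cos α * ‖sesqForm (harmonicMean s A B) x x‖) := by ring
    _ ≤ _ := h3.trans h2

theorem re_sesqForm_geometricMean_congruence {d : Fin n → ℝ} (hd : ∀ i, 0 < d i)
    {S : Matrix (Fin n) (Fin n) ℂ} (hS : IsUnit S) (hP : (Sᴴ * S).PosDef)
    (hQ : (Sᴴ * Matrix.diagonal (fun i => (d i : ℂ)) * S).PosDef)
    (ht : t ∈ Ioo (0 : ℝ) 1) (x : Fin n → ℂ) :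
    (sesqForm (geometricMean t (Sᴴ * S) (Sᴴ * Matrix.diagonal (fun i => (d i : ℂ)) * S)) x x).re =
      ∑ i, d i ^ t * ‖(S *ᵥ x) i‖ ^ 2 := by
  have hrep := (powMeasure_isRepresentingMeasure ht).2.2
  rw [re_sesqForm_geometricMean (accretive_of_posDef hP) (accretive_of_posDef hQ) ht]
  have e : ∫ s in Icc (0 : ℝ) 1, (sesqForm (harmonicMean s (Sᴴ * S)
      (Sᴴ * Matrix.diagonal (fun i => (d i : ℂ)) * S)) x x).re ∂(powMeasure t) =
      ∫ s in Icc (0 : ℝ) 1, ∑ i, ((1 - s) + s * (d i)⁻¹)⁻¹ * ‖(S *ᵥ x) i‖ ^ 2 ∂(powMeasure t) := by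
    refine setIntegral_congr_fun measurableSet_Icc fun s hs => ?_
    rw [harmonicMean_congruence hd hS hs, re_sesqForm_congruence_diagonal]
  have hint : ∀ i, IntegrableOn (fun s : ℝ => ((1 - s) + s * (d i)⁻¹)⁻¹) (Icc 0 1)
      (powMeasure t) := by
    intro i
    -- A non-integrable function has integral 0 by convention, but this integral equals d_i^t > 0.
    by_contra h
    have h1 := hrep (d i) (hd i)
    rw [integral_undef h] at h1
    exact (Real.rpow_pos_of_pos (hd i) t).ne' h1
  rw [e, integral_finsetSum _ fun i _ => (hint i).mul_const _]
  refine Finset.sum_congr rfl fun i _ => ?_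
  rw [integral_mul_const, ← hrep (d i) (hd i)]

end Integral

/-! ### Heinz inequalities for positive definite matrices -/

section PositiveDefinite

variable {P Q : Matrix (Fin n) (Fin n) ℂ} {t : ℝ}

/-- The geometric mean of positive definite matrices is at most their Heinz mean. -/
theorem re_geometricMean_le_re_heinzMean (hP : P.PosDef) (hQ : Q.PosDef)
    (ht : t ∈ Ioo (0 : ℝ) 1) (x : Fin n → ℂ) :
    2 * (sesqForm (geometricMean (1 / 2) P Q) x x).re ≤
      (sesqForm (geometricMean t P Q) x x).re +
        (sesqForm (geometricMean (1 - t) P Q) x x).re := by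
  obtain ⟨d, S, hd, hS, rfl, rfl⟩ := exists_simultaneous_diagonalization hP hQ
  rw [re_sesqForm_geometricMean_congruence hd hS hP hQ ⟨by norm_num, by norm_num⟩,
    re_sesqForm_geometricMean_congruence hd hS hP hQ ht,
    re_sesqForm_geometricMean_congruence hd hS hP hQ ⟨sub_pos.2 ht.2, by linarith [ht.1]⟩,
    Finset.mul_sum, ← Finset.sum_add_distrib]
  refine Finset.sum_le_sum fun i _ => ?_
  rw [← add_mul, ← mul_assoc]
  refine mul_le_mul_of_nonneg_right ?_ (sq_nonneg _)
  -- This is 2ab ≤ a² + b² with a = d^(t/2), b = d^((1-t)/2), whose product is √d.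
  have h : ∀ r : ℝ, d i ^ r = (d i ^ (r / 2)) ^ 2 := fun r => by
    rw [← Real.rpow_natCast, ← Real.rpow_mul (hd i).le]; congr 1; push_cast; ring
  have h' : d i ^ (1 / 2 : ℝ) = d i ^ (t / 2) * d i ^ ((1 - t) / 2) := by
    rw [← Real.rpow_add (hd i)]; congr 1; ring
  rw [h t, h (1 - t), h', ← mul_assoc]
  exact two_mul_le_add_sq _ _

/-- The Heinz mean of positive definite matrices is at most their arithmetic mean. -/
theorem re_heinzMean_le_re_add (hP : P.PosDef) (hQ : Q.PosDef)
    (ht : t ∈ Ioo (0 : ℝ) 1) (x : Fin n → ℂ) :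
    (sesqForm (geometricMean t P Q) x x).re + (sesqForm (geometricMean (1 - t) P Q) x x).re ≤
      (sesqForm P x x).re + (sesqForm Q x x).re := by
  obtain ⟨d, S, hd, hS, rfl, rfl⟩ := exists_simultaneous_diagonalization hP hQ
  have hP' : (sesqForm (Sᴴ * S) x x).re = ∑ i, (1 : ℝ) * ‖(S *ᵥ x) i‖ ^ 2 := by
    rw [← re_sesqForm_congruence_diagonal]
    simp
  rw [re_sesqForm_geometricMean_congruence hd hS hP hQ ht,
    re_sesqForm_geometricMean_congruence hd hS hP hQ ⟨sub_pos.2 ht.2, by linarith [ht.1]⟩,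
    hP', re_sesqForm_congruence_diagonal, ← Finset.sum_add_distrib, ← Finset.sum_add_distrib]
  refine Finset.sum_le_sum fun i _ => ?_
  rw [← add_mul, ← add_mul]
  refine mul_le_mul_of_nonneg_right ?_ (sq_nonneg _)
  -- Weighted AM–GM for d and 1; the bounds for r = t and r = 1 - t add up to d + 1.
  have h : ∀ r : ℝ, 0 ≤ r → r ≤ 1 → d i ^ r ≤ r * d i + (1 - r) := fun r h0 h1 => by
    have := Real.geom_mean_le_arith_mean2_weighted h0 (sub_nonneg.2 h1) (hd i).le zero_le_one
      (by ring)
    simpa using this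
  linarith [h t ht.1.le ht.2.le, h (1 - t) (by linarith [ht.2]) (by linarith [ht.1])]

end PositiveDefinite

theorem sesqForm_heinzMean (A B : Matrix (Fin n) (Fin n) ℂ) (t : ℝ) (x : Fin n → ℂ) :
    2 * sesqForm (heinzMean t A B) x x =
      sesqForm (geometricMean t A B) x x + sesqForm (geometricMean (1 - t) A B) x x := by
  simp only [sesqForm, heinzMean, Matrix.smul_mulVec, Matrix.add_mulVec, dotProduct_smul,
    dotProduct_add, smul_eq_mul]
  ring

end Sectorial

theorem mainTheorem12 (n : ℕ) (α : ℝ) (hα₀ : 0 ≤ α) (hα₁ : α < Real.pi / 2)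
    (A B : Matrix (Fin n) (Fin n) ℂ)
    (hA : Sectorial.Accretive A) (hB : Sectorial.Accretive B)
    (hAα : Sectorial.numericalRange A ⊆ Sectorial.sector α)
    (hBα : Sectorial.numericalRange B ⊆ Sectorial.sector α)
    (t : ℝ) (ht : t ∈ Set.Ioo (0 : ℝ) 1) :
    Real.cos α ^ 4 * Sectorial.numericalRadius (Sectorial.geometricMean (1 / 2) A B) ≤
        Sectorial.numericalRadius (Sectorial.heinzMean t A B) ∧
      Sectorial.numericalRadius (Sectorial.heinzMean t A B) ≤
        (1 / Real.cos α) ^ 4 / 2 * Sectorial.numericalRadius (A + B) := by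
  open Sectorial in
  have hc : 0 < Real.cos α := Real.cos_pos_of_mem_Ioo ⟨by linarith [Real.pi_pos], hα₁⟩
  have hc4 : 0 < Real.cos α ^ 4 := by positivity
  -- The form estimate holds with exponent 3, which is stronger than needed.
  have hpow : Real.cos α ^ 4 ≤ Real.cos α ^ 3 :=
    pow_le_pow_of_le_one hc.le (Real.cos_le_one α) (by norm_num)
  have ht' : 1 - t ∈ Set.Ioo (0 : ℝ) 1 := ⟨sub_pos.2 ht.2, by linarith [ht.1]⟩
  have hAs := formSectorial_of_numericalRange_subset hAα
  have hBs := formSectorial_of_numericalRange_subset hBα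
  have hbound : ∀ r ∈ Set.Ioo (0 : ℝ) 1, ∀ x : Fin n → ℂ,
      Real.cos α ^ 4 * ‖sesqForm (geometricMean r A B) x x‖ ≤
        (sesqForm (geometricMean r (rePart A) (rePart B)) x x).re := fun r hr x =>
    (mul_le_mul_of_nonneg_right hpow (norm_nonneg _)).trans
      (cos_pow_three_mul_norm_geometricMean_le hα₀ hα₁ hA hB hAs hBs hr x)
  constructor
  · rw [mul_comm, ← le_div_iff₀ hc4]
    refine numericalRadius_le (div_nonneg (numericalRadius_nonneg _) hc4.le) fun x hx => ?_
    rw [le_div_iff₀ hc4, mul_comm]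
    refine le_trans ?_ (norm_sesqForm_le_numericalRadius _ hx)
    refine le_trans ?_ (Complex.re_le_norm _)
    -- Chain at `x`: A ♯ B to Re A ♯ Re B, then to the Heinz mean of the real parts, then up to the
    -- real part of the Heinz mean of `A`, `B`.
    have h1 := hbound (1 / 2) ⟨by norm_num, by norm_num⟩ x.ofLp
    have h2 := re_geometricMean_le_re_heinzMean hA hB ht x.ofLp
    have h3 := re_geometricMean_rePart_le hA hB ht x.ofLp
    have h4 := re_geometricMean_rePart_le hA hB ht' x.ofLp
    have h5 := congrArg Complex.re (sesqForm_heinzMean A B t x.ofLp)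
    simp only [Complex.add_re, Complex.mul_re, Complex.re_ofNat, Complex.im_ofNat, zero_mul,
      sub_zero] at h5
    linarith
  · have e : (1 / Real.cos α) ^ 4 / 2 * numericalRadius (A + B) =
        numericalRadius (A + B) / (Real.cos α ^ 4 * 2) := by
      field_simp
    rw [e]
    refine numericalRadius_le (div_nonneg (numericalRadius_nonneg _) (by positivity))
      fun x hx => ?_
    rw [le_div_iff₀ (by positivity)]
    refine le_trans ?_ (norm_sesqForm_le_numericalRadius _ hx)
    refine le_trans ?_ (Complex.re_le_norm _)
    -- Both halves of the Heinz mean descend to means of the real parts, whose sum is at most Re A +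
    -- Re B.
    have h1 := hbound t ht x.ofLp
    have h2 := hbound (1 - t) ht' x.ofLp
    have h3 := re_heinzMean_le_re_add hA hB ht x.ofLp
    rw [re_sesqForm_rePart, re_sesqForm_rePart] at h3
    have h4 := congrArg norm (sesqForm_heinzMean A B t x.ofLp)
    rw [norm_mul, Complex.norm_two] at h4
    have h5 := mul_le_mul_of_nonneg_left (h4.le.trans (norm_add_le _ _)) hc4.le
    have h6 : (sesqForm (A + B) x.ofLp x.ofLp).re =
        (sesqForm A x.ofLp x.ofLp).re + (sesqForm B x.ofLp x.ofLp).re := by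
      simp only [sesqForm, Matrix.add_mulVec, dotProduct_add, Complex.add_re]
    rw [h6]
    linarith
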